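/- Let $\mathbb K$ be $\mathbb R$ or $\mathbb C$, let $T$ be an uncountable set, and let $(B_t)_{t\in T}$ be a family of Banach spaces over $\mathbb K$. For any family of locally convex spaces, the locally convex direct sum $\bigoplus$ is the space of families with finitely many non-zero members, endowed with the finest locally convex vector space topology for which all embeddings of the summands are continuous. An (LB)-space is a strict inductive limit, in the category of locally convex spaces, of a sequence of Banach spaces. A linear subspace (with the subspace topology) is complemented if there is a continuous linear projection of the whole space onto it. Let $X$ be a complemented subspace of $\bigoplus_{t\in T} B_t$. Then there are a set $J$ and, for every $j\in J$, a countably infinite subset $T_j\subseteq T$ and a complemented subspace $F_j$ of $\bigoplus_{t\in T_j} B_t$, such that every $F_j$ is an (LB)-space and $X$ is topologically isomorphic, as a topological vector space, to the locally convex direct sum $\bigoplus_{j\in J} F_j$. -/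

import Mathlib

open Topology
open scoped ComplexOrder

universe u v w

/-- The finest locally convex vector space topology on `F` for which all the linear maps
`f i : E i → F` are continuous. (In Mathlib's order on topologies, finer means smaller; local
convexity and continuity of the `f i` pass to infima, so the infimum below is attained.) -/
@[reducible]
def finestLocallyConvexTopology (𝕜 : Type*) [RCLike 𝕜] {ι : Type*} {E : ι → Type*}
    [∀ i, AddCommGroup (E i)] [∀ i, Module 𝕜 (E i)] [∀ i, TopologicalSpace (E i)]
    {F : Type*} [AddCommGroup F] [Module 𝕜 F] (f : ∀ i, E i →ₗ[𝕜] F) : TopologicalSpace F :=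
  sInf {t : TopologicalSpace F | @IsTopologicalAddGroup F t _ ∧ @ContinuousSMul 𝕜 F _ _ t ∧
    @LocallyConvexSpace 𝕜 F _ _ _ _ t ∧ ∀ i, @Continuous (E i) F _ t (f i)}

/-- The locally convex direct sum of a family of topological vector spaces over `𝕜`. As a vector
space it consists of the families with finitely many non-zero members. -/
def LCDirectSum (𝕜 : Type u) [RCLike 𝕜] {ι : Type v} (E : ι → Type w)
    [∀ i, AddCommGroup (E i)] : Type (max v w) :=
  Π₀ i, E i

namespace LCDirectSum

variable (𝕜 : Type u) [RCLike 𝕜] {ι : Type v} (E : ι → Type w) [∀ i, AddCommGroup (E i)]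

instance : AddCommGroup (LCDirectSum 𝕜 E) :=
  inferInstanceAs (AddCommGroup (Π₀ i, E i))

variable [∀ i, Module 𝕜 (E i)]

instance : Module 𝕜 (LCDirectSum 𝕜 E) :=
  inferInstanceAs (Module 𝕜 (Π₀ i, E i))

open Classical in
/-- The natural embedding of a summand into the direct sum. -/
noncomputable def incl (i : ι) : E i →ₗ[𝕜] LCDirectSum 𝕜 E :=
  (DFinsupp.lsingle i : E i →ₗ[𝕜] Π₀ i, E i)

variable [∀ i, TopologicalSpace (E i)]

noncomputable instance : TopologicalSpace (LCDirectSum 𝕜 E) :=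
  finestLocallyConvexTopology 𝕜 (incl 𝕜 E)

instance : IsTopologicalAddGroup (LCDirectSum 𝕜 E) :=
  topologicalAddGroup_sInf fun _ h ↦ h.1

instance : ContinuousSMul 𝕜 (LCDirectSum 𝕜 E) :=
  continuousSMul_sInf fun _ h ↦ h.2.1

instance : LocallyConvexSpace 𝕜 (LCDirectSum 𝕜 E) :=
  LocallyConvexSpace.sInf fun _ h ↦ h.2.2.1

end LCDirectSum

/-- A topological vector space `F` is an (LB)-space if it is the strict inductive limit of a
sequence of Banach spaces: there are Banach spaces `B 0, B 1, …`, linear topological embeddings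
`j n : B n → B (n + 1)`, and compatible injective linear maps `i n : B n → F` whose ranges cover
`F`, such that `F` has the finest locally convex topology making all `i n` continuous. -/
def IsLBSpace (𝕜 : Type u) [RCLike 𝕜] (F : Type v) [AddCommGroup F] [Module 𝕜 F]
    [tF : TopologicalSpace F] : Prop :=
  ∃ (B : ℕ → Type v) (_ : ∀ n, NormedAddCommGroup (B n)) (_ : ∀ n, NormedSpace 𝕜 (B n))
    (_ : ∀ n, CompleteSpace (B n)) (j : ∀ n, B n →L[𝕜] B (n + 1)) (i : ∀ n, B n →ₗ[𝕜] F),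
    (∀ n, IsEmbedding (j n)) ∧
    (∀ n x, i (n + 1) (j n x) = i n x) ∧
    (∀ n, Function.Injective (i n)) ∧
    (∀ y : F, ∃ n x, i n x = y) ∧
    tF = finestLocallyConvexTopology 𝕜 i

/-! Let `P` be the projection onto `X`. By Baire, `P` sends each `B t` into a finite subsum
(`finite_setOf_exists_proj_ne_zero`), so the relation "the matrix entry of `P` from `t` to `s` is
nonzero" has finite out-degrees. Hence `T` splits into countably infinite pieces, indexed by a
well-order, for which `P` is block triangular (`exists_wellOrdered_partition`).

The diagonal blocks of a triangular idempotent are idempotent, so they assemble to a block diagonal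
idempotent `D` whose range is the direct sum of their ranges. Put `U = P D + (1 - P)(1 - D)`; then
`U D = P D = P U`. Moreover `1 - U` is strictly triangular, and well-foundedness makes `U`
invertible (`exists_equiv_apply_eq_sub`), so `U` carries the range of `D` onto `X`. Each summand is
complemented in a countable sum of Banach spaces, hence is the strict limit of its intersections
with finite subsums (`isLBSpace_of_closedComplemented`). -/

section FinestTopology

variable {𝕜 : Type*} [RCLike 𝕜] {ι : Type*} {E : ι → Type*}
  [∀ i, AddCommGroup (E i)] [∀ i, Module 𝕜 (E i)] [∀ i, TopologicalSpace (E i)]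
  {F : Type*} [AddCommGroup F] [Module 𝕜 F]

theorem continuous_finestLocallyConvexTopology (f : ∀ i, E i →ₗ[𝕜] F) (i : ι) :
    @Continuous (E i) F _ (finestLocallyConvexTopology 𝕜 f) (f i) :=
  continuous_sInf_rng.2 fun _ h ↦ h.2.2.2 i

theorem finestLocallyConvexTopology_le_induced (f : ∀ i, E i →ₗ[𝕜] F)
    {G : Type*} [AddCommGroup G] [Module 𝕜 G] [tG : TopologicalSpace G] [IsTopologicalAddGroup G]
    [ContinuousSMul 𝕜 G] [LocallyConvexSpace 𝕜 G] (g : F →ₗ[𝕜] G)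
    (h : ∀ i, Continuous (g ∘ₗ f i)) :
    finestLocallyConvexTopology 𝕜 f ≤ tG.induced g :=
  sInf_le ⟨topologicalAddGroup_induced g, continuousSMul_induced g,
    LocallyConvexSpace.induced g, fun i ↦ continuous_induced_rng.2 (h i)⟩

end FinestTopology

theorem NormedSpace.locallyConvexSpace_of_rclike {𝕜 : Type*} [RCLike 𝕜] {E : Type*}
    [NormedAddCommGroup E] [NormedSpace 𝕜 E] : LocallyConvexSpace 𝕜 E := by
  refine LocallyConvexSpace.ofBases 𝕜 E (fun x r ↦ Metric.ball x r) (fun _ r ↦ 0 < r)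
    (fun x ↦ Metric.nhds_basis_ball) fun x r _ ↦ ?_
  intro y hy z hz a b ha hb hab
  -- Convexity is over `𝕜` with its partial order; nonnegative scalars are real and equal their
  -- norms.
  have hnorm : ‖a‖ + ‖b‖ = 1 := by
    have : ((‖a‖ + ‖b‖ : ℝ) : 𝕜) = (1 : ℝ) := by
      have ha' : ((‖a‖ : ℝ) : 𝕜) = a := RCLike.norm_of_nonneg' ha
      have hb' : ((‖b‖ : ℝ) : 𝕜) = b := RCLike.norm_of_nonneg' hb
      rw [RCLike.ofReal_add, ha', hb', hab, RCLike.ofReal_one]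
    exact_mod_cast this
  have hsub : a • y + b • z - x = a • (y - x) + b • (z - x) := by
    rw [smul_sub, smul_sub, sub_add_sub_comm, ← add_smul, hab, one_smul]
  rw [mem_ball_iff_norm] at hy hz ⊢
  rw [hsub]
  calc ‖a • (y - x) + b • (z - x)‖ ≤ ‖a‖ * ‖y - x‖ + ‖b‖ * ‖z - x‖ :=
        (norm_add_le _ _).trans (by rw [norm_smul, norm_smul])
    _ < r := (convex_Iio r) hy hz (norm_nonneg a) (norm_nonneg b) hnorm

attribute [local instance] NormedSpace.locallyConvexSpace_of_rclike

/-! ### Coordinates and universal property of direct sums -/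

namespace LCDirectSum

section Algebra

variable {𝕜 : Type u} [RCLike 𝕜] {ι : Type v} {E : ι → Type w} [∀ i, AddCommGroup (E i)]
  [∀ i, Module 𝕜 (E i)]

variable (𝕜 E) in
/-- The coordinate maps of a direct sum. -/
def proj (i : ι) : LCDirectSum 𝕜 E →ₗ[𝕜] E i :=
  (DFinsupp.lapply i : (Π₀ i, E i) →ₗ[𝕜] E i)

@[ext]
theorem ext {x y : LCDirectSum 𝕜 E} (h : ∀ i, proj 𝕜 E i x = proj 𝕜 E i y) : x = y :=
  DFinsupp.ext h

@[simp]
theorem proj_incl_self (i : ι) (b : E i) : proj 𝕜 E i (incl 𝕜 E i b) = b := by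
  classical
  exact DFinsupp.single_eq_same (β := E)

theorem proj_incl_of_ne {i k : ι} (h : i ≠ k) (b : E k) : proj 𝕜 E i (incl 𝕜 E k b) = 0 := by
  classical
  exact DFinsupp.single_eq_of_ne (β := E) h

theorem finite_setOf_proj_ne_zero (x : LCDirectSum 𝕜 E) : {i | proj 𝕜 E i x ≠ 0}.Finite :=
  DFinsupp.finite_support (x : Π₀ i, E i)

theorem sum_incl_proj (x : LCDirectSum 𝕜 E) (s : Finset ι) (hs : ∀ i ∉ s, proj 𝕜 E i x = 0) :
    ∑ i ∈ s, incl 𝕜 E i (proj 𝕜 E i x) = x := by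
  ext i
  rw [map_sum]
  by_cases hi : i ∈ s
  · rw [Finset.sum_eq_single_of_mem i hi fun k _ hk ↦ proj_incl_of_ne hk.symm _, proj_incl_self]
  · rw [hs i hi]
    exact Finset.sum_eq_zero fun k hk ↦ proj_incl_of_ne (ne_of_mem_of_not_mem hk hi).symm _

theorem exists_sum_incl_proj (x : LCDirectSum 𝕜 E) :
    ∃ s : Finset ι, (∀ i ∈ s, proj 𝕜 E i x ≠ 0) ∧ ∑ i ∈ s, incl 𝕜 E i (proj 𝕜 E i x) = x :=
  ⟨(finite_setOf_proj_ne_zero x).toFinset, by simp, sum_incl_proj x _ (by simp)⟩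

variable {G : Type*} [AddCommGroup G] [Module 𝕜 G]

theorem linearMap_ext {g h : LCDirectSum 𝕜 E →ₗ[𝕜] G}
    (H : ∀ i b, g (incl 𝕜 E i b) = h (incl 𝕜 E i b)) : g = h := by
  ext x
  obtain ⟨s, -, hs⟩ := exists_sum_incl_proj x
  rw [← hs, map_sum, map_sum]
  exact Finset.sum_congr rfl fun i _ ↦ H i _

theorem mem_of_forall_incl_mem {M : Submodule 𝕜 G} (g : LCDirectSum 𝕜 E →ₗ[𝕜] G)
    (x : LCDirectSum 𝕜 E) (h : ∀ i, proj 𝕜 E i x ≠ 0 → ∀ b, g (incl 𝕜 E i b) ∈ M) : g x ∈ M := by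
  obtain ⟨s, hs, hx⟩ := exists_sum_incl_proj x
  rw [← hx, map_sum]
  exact M.sum_mem fun i hi ↦ h i (hs i hi) _

end Algebra

section Topology

variable {𝕜 : Type u} [RCLike 𝕜] {ι : Type v} {E : ι → Type w} [∀ i, AddCommGroup (E i)]
  [∀ i, Module 𝕜 (E i)] [∀ i, TopologicalSpace (E i)]
  {G : Type*} [AddCommGroup G] [Module 𝕜 G] [TopologicalSpace G]

variable (𝕜 E) in
/-- The embedding of a summand as a continuous linear map. -/
noncomputable def inclL (i : ι) : E i →L[𝕜] LCDirectSum 𝕜 E :=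
  ⟨incl 𝕜 E i, continuous_finestLocallyConvexTopology _ i⟩

@[simp]
theorem inclL_apply (i : ι) (b : E i) : inclL 𝕜 E i b = incl 𝕜 E i b := rfl

theorem continuousLinearMap_ext {g h : LCDirectSum 𝕜 E →L[𝕜] G}
    (H : ∀ i b, g (incl 𝕜 E i b) = h (incl 𝕜 E i b)) : g = h :=
  ContinuousLinearMap.coe_injective (linearMap_ext H)

variable [IsTopologicalAddGroup G] [ContinuousSMul 𝕜 G] [LocallyConvexSpace 𝕜 G]

theorem continuous_of_comp_incl (g : LCDirectSum 𝕜 E →ₗ[𝕜] G)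
    (h : ∀ i, Continuous (g ∘ₗ incl 𝕜 E i)) : Continuous g :=
  continuous_iff_le_induced.2 (finestLocallyConvexTopology_le_induced _ g h)

open Classical in
/-- The continuous linear map on a direct sum with given restrictions to the summands. -/
noncomputable def lift (f : ∀ i, E i →L[𝕜] G) : LCDirectSum 𝕜 E →L[𝕜] G :=
  haveI key : ∀ i (b : E i), (DFinsupp.lsum ℕ (fun i ↦ (f i : E i →ₗ[𝕜] G)) : (Π₀ i, E i) →ₗ[𝕜] G)
      (DFinsupp.single (β := E) i b) = f i b := fun i b ↦ by simp
  ⟨(DFinsupp.lsum ℕ (fun i ↦ (f i : E i →ₗ[𝕜] G)) : (Π₀ i, E i) →ₗ[𝕜] G),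
    continuous_of_comp_incl (E := E) _ fun i ↦
      (f i).continuous.congr fun b ↦ (key i b).symm⟩

@[simp]
theorem lift_incl (f : ∀ i, E i →L[𝕜] G) (i : ι) (b : E i) :
    lift f (incl 𝕜 E i b) = f i b := by
  classical
  exact DFinsupp.lsum_single ..

variable [∀ i, IsTopologicalAddGroup (E i)] [∀ i, ContinuousSMul 𝕜 (E i)]
  [∀ i, LocallyConvexSpace 𝕜 (E i)]

theorem continuous_proj (i : ι) : Continuous (proj 𝕜 E i) := by
  refine continuous_of_comp_incl _ fun k ↦ ?_
  by_cases h : i = k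
  · subst h
    exact continuous_id.congr fun b ↦ (proj_incl_self (𝕜 := 𝕜) i b).symm
  · exact continuous_const.congr fun b ↦ (proj_incl_of_ne (𝕜 := 𝕜) h b).symm

variable (𝕜 E) in
/-- The coordinate maps as continuous linear maps. -/
def projL (i : ι) : LCDirectSum 𝕜 E →L[𝕜] E i := ⟨proj 𝕜 E i, continuous_proj i⟩

@[simp]
theorem projL_apply (i : ι) (x : LCDirectSum 𝕜 E) : projL 𝕜 E i x = proj 𝕜 E i x := rfl

instance [∀ i, T2Space (E i)] : T2Space (LCDirectSum 𝕜 E) :=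
  T2Space.of_injective_continuous (f := fun x i ↦ proj 𝕜 E i x)
    (fun _ _ h ↦ ext (congrFun h)) (continuous_pi continuous_proj)

end Topology

section Restriction

variable {𝕜 : Type u} [RCLike 𝕜] {ι : Type v} {E : ι → Type w} [∀ i, AddCommGroup (E i)]
  [∀ i, Module 𝕜 (E i)] [∀ i, TopologicalSpace (E i)] (S : Set ι)

variable (𝕜 E) in
/-- Extension by zero from a set of indices. -/
noncomputable def extend : LCDirectSum 𝕜 (fun i : S ↦ E i) →L[𝕜] LCDirectSum 𝕜 E :=
  lift fun i : S ↦ inclL 𝕜 E i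

open Classical in
variable (𝕜 E) in
/-- Restriction to a set of indices. -/
noncomputable def restrict : LCDirectSum 𝕜 E →L[𝕜] LCDirectSum 𝕜 (fun i : S ↦ E i) :=
  lift fun i : ι ↦ if h : i ∈ S then inclL 𝕜 (fun i : S ↦ E i) ⟨i, h⟩ else 0

@[simp]
theorem extend_incl (i : S) (b : E i) :
    extend 𝕜 E S (incl 𝕜 (fun i : S ↦ E i) i b) = incl 𝕜 E i b :=
  lift_incl ..

theorem restrict_incl_of_mem {i : ι} (h : i ∈ S) (b : E i) :
    restrict 𝕜 E S (incl 𝕜 E i b) = incl 𝕜 (fun i : S ↦ E i) ⟨i, h⟩ b := by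
  simp [restrict, h]

theorem restrict_incl_of_notMem {i : ι} (h : i ∉ S) (b : E i) :
    restrict 𝕜 E S (incl 𝕜 E i b) = 0 := by
  simp [restrict, h]

@[simp]
theorem restrict_extend (y : LCDirectSum 𝕜 (fun i : S ↦ E i)) :
    restrict 𝕜 E S (extend 𝕜 E S y) = y := by
  have : (restrict 𝕜 E S).comp (extend 𝕜 E S) = .id 𝕜 _ :=
    continuousLinearMap_ext fun i b ↦ by simp [restrict_incl_of_mem]
  exact DFunLike.congr_fun this y

@[simp]
theorem proj_restrict (i : S) (x : LCDirectSum 𝕜 E) :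
    proj 𝕜 (fun i : S ↦ E i) i (restrict 𝕜 E S x) = proj 𝕜 E i x := by
  have : proj 𝕜 (fun i : S ↦ E i) i ∘ₗ 
      (restrict 𝕜 E S : LCDirectSum 𝕜 E →ₗ[𝕜] LCDirectSum 𝕜 (fun i : S ↦ E i)) = proj 𝕜 E i := by
    refine linearMap_ext fun k b ↦ ?_
    by_cases hk : k ∈ S
    · by_cases hik : i = ⟨k, hk⟩
      · subst hik
        simp [restrict_incl_of_mem S hk]
      · have hne : (i : ι) ≠ k := fun h ↦ hik (Subtype.ext h)
        simp [restrict_incl_of_mem S hk, proj_incl_of_ne hik, proj_incl_of_ne hne]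
    · have hne : (i : ι) ≠ k := fun h ↦ hk (h ▸ i.2)
      simp [restrict_incl_of_notMem S hk, proj_incl_of_ne hne]
  exact DFunLike.congr_fun this x

theorem proj_extend_of_mem {i : ι} (h : i ∈ S) (y : LCDirectSum 𝕜 (fun i : S ↦ E i)) :
    proj 𝕜 E i (extend 𝕜 E S y) = proj 𝕜 (fun i : S ↦ E i) ⟨i, h⟩ y := by
  rw [← proj_restrict S ⟨i, h⟩, restrict_extend]

theorem proj_extend_of_notMem {i : ι} (h : i ∉ S) (y : LCDirectSum 𝕜 (fun i : S ↦ E i)) :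
    proj 𝕜 E i (extend 𝕜 E S y) = 0 := by
  have : proj 𝕜 E i ∘ₗ
      (extend 𝕜 E S : LCDirectSum 𝕜 (fun i : S ↦ E i) →ₗ[𝕜] LCDirectSum 𝕜 E) = 0 := by
    refine linearMap_ext fun k b ↦ ?_
    have hne : i ≠ k := fun e ↦ h (e ▸ k.2)
    simp [proj_incl_of_ne hne]
  exact DFunLike.congr_fun this y

end Restriction

/-! ### Maps from Banach spaces, via Baire -/

section Banach

variable {𝕜 : Type u} [RCLike 𝕜] {ι : Type v} {E : ι → Type w} [∀ i, NormedAddCommGroup (E i)]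
  [∀ i, NormedSpace 𝕜 (E i)]

/-- A continuous linear map from a Banach space to a direct sum of normed spaces has its range in
a finite subsum. -/
theorem finite_setOf_exists_proj_ne_zero {G : Type*} [NormedAddCommGroup G] [NormedSpace 𝕜 G]
    [CompleteSpace G] (g : G →L[𝕜] LCDirectSum 𝕜 E) :
    {i | ∃ b, proj 𝕜 E i (g b) ≠ 0}.Finite := by
  by_contra hinf
  have : Infinite {i | ∃ b, proj 𝕜 E i (g b) ≠ 0} := Set.infinite_coe_iff.2 hinf
  let s := Infinite.natEmbedding {i | ∃ b, proj 𝕜 E i (g b) ≠ 0}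
  -- These closed subspaces cover `G` because each `g b` has finite support. By Baire one of them,
  -- `M n`, has interior points, so it is all of `G`, against the choice of `s n`.
  let M : ℕ → Submodule 𝕜 G := fun n ↦ ⨅ k ≥ n, ((projL 𝕜 E (s k)).comp g).ker
  have hM : ∀ n b, b ∈ M n ↔ ∀ k ≥ n, proj 𝕜 E (s k) (g b) = 0 := by
    intro n b
    simp [M, Submodule.mem_iInf]
  have hclosed : ∀ n, IsClosed (M n : Set G) := by
    intro n
    simp only [M, Submodule.coe_iInf]
    exact isClosed_iInter fun k ↦ isClosed_iInter fun _ ↦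
      ((projL 𝕜 E (s k)).comp g).isClosed_ker
  have hcover : ⋃ n, (M n : Set G) = Set.univ := by
    refine Set.eq_univ_of_forall fun b ↦ ?_
    have hfin : {k | proj 𝕜 E (s k) (g b) ≠ 0}.Finite :=
      (finite_setOf_proj_ne_zero (g b)).preimage (f := fun k ↦ (s k : ι))
        (Subtype.val_injective.comp s.injective).injOn
    obtain ⟨n, hn⟩ := hfin.bddAbove
    refine Set.mem_iUnion.2 ⟨n + 1, (hM _ _).2 fun k hk ↦ ?_⟩
    by_contra h
    have := hn h
    omega
  obtain ⟨n, hn⟩ := nonempty_interior_of_iUnion_of_closed hclosed hcover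
  have htop := (M n).eq_top_of_nonempty_interior' hn
  obtain ⟨b, hb⟩ := (s n).2
  exact hb ((hM n b).1 (htop ▸ Submodule.mem_top) n le_rfl)

end Banach

end LCDirectSum

/-! ### Well-ordered partitions into countable pieces -/

theorem countable_setOf_reflTransGen {α : Type*} {r : α → α → Prop}
    (h : ∀ a, {b | r a b}.Countable) (a : α) : {b | Relation.ReflTransGen r a b}.Countable := by
  let S : ℕ → Set α := fun n ↦ Nat.rec {a} (fun _ A ↦ ⋃ b ∈ A, {c | r b c}) n
  have hS : ∀ n, (S n).Countable := by
    intro n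
    induction n with
    | zero => exact Set.countable_singleton a
    | succ n ih => exact ih.biUnion fun b _ ↦ h b
  refine (Set.countable_iUnion hS).mono fun b hb ↦ ?_
  induction hb with
  | refl => exact Set.mem_iUnion.2 ⟨0, rfl⟩
  | tail _ hbc ih =>
    obtain ⟨n, hn⟩ := Set.mem_iUnion.1 ih
    exact Set.mem_iUnion.2 ⟨n + 1, Set.mem_biUnion hn hbc⟩

/-- A relation with countable out-degrees on an infinite set is compatible with a partition into
countably infinite pieces that are indexed by a well-order. -/
theorem exists_wellOrdered_partition {T : Type u} [Infinite T] (Φ : T → Set T)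
    (hΦ : ∀ t, (Φ t).Countable) :
    ∃ (J : Type u) (_ : LinearOrder J) (_ : WellFoundedLT J) (f : T → J),
      (∀ t, ∀ s ∈ Φ t, f s ≤ f t) ∧ ∀ j, Cardinal.mk (f ⁻¹' {j}) = Cardinal.aleph0 := by
  -- Grouping `T` into countably infinite packets, the fibres of `g`, and working with whole packets
  -- forces the pieces to be infinite.
  obtain ⟨e⟩ : Nonempty (T ≃ T × ℕ) := by
    rw [← Cardinal.lift_mk_eq'.{u, u}]
    simp [Cardinal.mul_aleph0_eq (Cardinal.aleph0_le_mk T)]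
  let g : T → T := fun t ↦ (e t).1
  have hg : ∀ a, (g ⁻¹' {a}).Countable := fun a ↦ by
    refine (Set.countable_range fun n : ℕ ↦ e.symm (a, n)).mono fun t ht ↦ Set.mem_range.2 ⟨(e t).2, ?_⟩
    have : (e t).1 = a := ht
    simp [← this]
  let r : T → T → Prop := fun a b ↦ ∃ t, g t = a ∧ ∃ s ∈ Φ t, g s = b
  have hr : ∀ a, {b | r a b}.Countable := fun a ↦ by
    refine ((hg a).biUnion fun t _ ↦ (hΦ t).image g).mono ?_
    rintro b ⟨t, ht, s, hs, rfl⟩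
    exact Set.mem_biUnion (x := t) ht ⟨s, hs, rfl⟩
  obtain ⟨_, _⟩ := exists_wellFoundedLT T
  have hne : ∀ t, {a | Relation.ReflTransGen r a (g t)}.Nonempty := fun t ↦ ⟨g t, .refl⟩
  -- The least point from which the packet of `t` can be reached. An edge from `t` to `s` keeps `f
  -- t` an ancestor of `s`, so `f` cannot increase; a fibre of `f` lies among the countably many
  -- descendants of one point.
  let f : T → T := fun t ↦ wellFounded_lt.min _ (hne t)
  have hf : ∀ t, Relation.ReflTransGen r (f t) (g t) := fun t ↦ wellFounded_lt.min_mem _ (hne t)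
  have hmin : ∀ t a, Relation.ReflTransGen r a (g t) → f t ≤ a := fun t a h ↦
    wellFounded_lt.min_le (s := {a | Relation.ReflTransGen r a (g t)}) h
  refine ⟨Set.range f, inferInstance, inferInstance, Set.rangeFactorization f, ?_, ?_⟩
  · exact fun t s hs ↦ hmin s (f t) ((hf t).tail ⟨t, rfl, s, hs, rfl⟩)
  · rintro ⟨_, t, rfl⟩
    refine le_antisymm ?_ ?_
    · rw [Cardinal.le_aleph0_iff_set_countable]
      refine ((countable_setOf_reflTransGen hr (f t)).biUnion fun b _ ↦ hg b).mono fun s hs ↦ ?_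
      have hs' : f s = f t := congrArg Subtype.val hs
      exact Set.mem_biUnion (x := g s) (hs' ▸ hf s : Relation.ReflTransGen r (f t) (g s)) rfl
    · rw [Cardinal.aleph0_le_mk_iff]
      refine Infinite.of_injective (fun n : ℕ ↦ (⟨e.symm (g t, n), ?_⟩ : _ ⁻¹' _)) ?_
      · have : g (e.symm (g t, n)) = g t := by simp [g]
        refine Subtype.ext ?_
        simp only [Set.rangeFactorization_coe, f, this]
      · intro m n h
        simpa using congrArg Subtype.val h

/-! ### Countable sums and (LB)-spaces -/

namespace LCDirectSum

section FiniteSubsums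

variable {𝕜 : Type u} [RCLike 𝕜] {ι : Type v} {E : ι → Type w} [∀ i, NormedAddCommGroup (E i)]
  [∀ i, NormedSpace 𝕜 (E i)] (A : Finset ι)

variable (𝕜 E) in
/-- The inclusion of a finite product in the direct sum. -/
noncomputable def ofPi : (∀ i : A, E i) →L[𝕜] LCDirectSum 𝕜 E :=
  ∑ i : A, (inclL 𝕜 E i).comp (ContinuousLinearMap.proj (R := 𝕜) (φ := fun i : A ↦ E i) i)

variable (𝕜 E) in
/-- The projection of the direct sum to a finite product. -/
noncomputable def toPi : LCDirectSum 𝕜 E →L[𝕜] (∀ i : A, E i) :=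
  ContinuousLinearMap.pi fun i : A ↦ projL 𝕜 E i

@[simp]
theorem toPi_apply (x : LCDirectSum 𝕜 E) (i : A) : toPi 𝕜 E A x i = proj 𝕜 E i x := rfl

theorem ofPi_apply (x : ∀ i : A, E i) : ofPi 𝕜 E A x = ∑ i : A, incl 𝕜 E i (x i) := by
  simp [ofPi]

theorem proj_ofPi_of_notMem (x : ∀ i : A, E i) {i : ι} (h : i ∉ A) :
    proj 𝕜 E i (ofPi 𝕜 E A x) = 0 := by
  rw [ofPi_apply, map_sum]
  exact Finset.sum_eq_zero fun k _ ↦ proj_incl_of_ne (ne_of_mem_of_not_mem k.2 h).symm _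

@[simp]
theorem toPi_ofPi (x : ∀ i : A, E i) : toPi 𝕜 E A (ofPi 𝕜 E A x) = x := by
  funext i
  rw [toPi_apply, ofPi_apply, map_sum, Finset.sum_eq_single_of_mem i (Finset.mem_univ i),
    proj_incl_self]
  exact fun k _ hk ↦ proj_incl_of_ne (fun h ↦ hk (Subtype.ext h.symm)) _

theorem ofPi_toPi {x : LCDirectSum 𝕜 E} (hx : ∀ i ∉ A, proj 𝕜 E i x = 0) :
    ofPi 𝕜 E A (toPi 𝕜 E A x) = x := by
  rw [ofPi_apply]
  simp only [toPi_apply]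
  rw [Finset.sum_coe_sort A fun i ↦ incl 𝕜 E i (proj 𝕜 E i x)]
  exact sum_incl_proj x A hx

end FiniteSubsums

section LB

variable {𝕜 : Type u} [RCLike 𝕜] {ι : Type v} {E : ι → Type w}

/-- As `Q` fixes `F`, the map `g` is the restriction to `F` of `g ∘ Q`, whose continuity can be
tested on summands. -/
theorem continuous_of_retract [∀ i, AddCommGroup (E i)] [∀ i, Module 𝕜 (E i)]
    [∀ i, TopologicalSpace (E i)]
    {F : Submodule 𝕜 (LCDirectSum 𝕜 E)} (Q : LCDirectSum 𝕜 E →L[𝕜] F) (hQ : ∀ y : F, Q y = y)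
    {G : Type*} [AddCommGroup G] [Module 𝕜 G] [TopologicalSpace G] [IsTopologicalAddGroup G]
    [ContinuousSMul 𝕜 G] [LocallyConvexSpace 𝕜 G] (g : F →ₗ[𝕜] G)
    (h : ∀ i, Continuous fun b : E i ↦ g (Q (incl 𝕜 E i b))) : Continuous g :=
  ((continuous_of_comp_incl (g ∘ₗ (Q : LCDirectSum 𝕜 E →ₗ[𝕜] F)) h).comp
    continuous_subtype_val).congr fun y ↦ congrArg g (hQ y)

variable [∀ i, NormedAddCommGroup (E i)] [∀ i, NormedSpace 𝕜 (E i)] [∀ i, CompleteSpace (E i)]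

/-- A complemented subspace of a countable direct sum of Banach spaces is an (LB)-space. -/
theorem isLBSpace_of_closedComplemented [Countable ι] (F : Submodule 𝕜 (LCDirectSum 𝕜 E))
    (hF : F.ClosedComplemented) : IsLBSpace 𝕜 F := by
  obtain ⟨c, hc⟩ := exists_injective_nat ι
  let A : ℕ → Finset ι := fun n ↦ ((Set.finite_Iio n).preimage (f := c) hc.injOn).toFinset
  have hA : ∀ n i, i ∈ A n ↔ c i < n := fun n i ↦ by simp [A]
  have hcover : ∀ s : Set ι, s.Finite → ∃ n, s ⊆ A n := by
    intro s hs
    obtain ⟨n, hn⟩ := (hs.image c).bddAbove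
    exact ⟨n + 1, fun i hi ↦ (hA _ _).2 (Nat.lt_succ_of_le (hn (Set.mem_image_of_mem c hi)))⟩
  have hFclosed : IsClosed (F : Set (LCDirectSum 𝕜 E)) := hF.isClosed
  -- The part of `F` in the `n`-th finite subsum: closed in a finite product of Banach spaces, hence
  -- Banach.
  let B : ∀ n, Submodule 𝕜 (∀ i : A n, E i) := fun n ↦
    F.comap (ofPi 𝕜 E (A n) : (∀ i : A n, E i) →ₗ[𝕜] LCDirectSum 𝕜 E)
  have hB : ∀ n, IsClosed (B n : Set (∀ i : A n, E i)) := fun n ↦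
    hFclosed.preimage (ofPi 𝕜 E (A n)).continuous
  have hsucc : ∀ n (x : ∀ i : A n, E i),
      ofPi 𝕜 E (A (n + 1)) (toPi 𝕜 E (A (n + 1)) (ofPi 𝕜 E (A n) x)) = ofPi 𝕜 E (A n) x :=
    fun n x ↦ ofPi_toPi _ fun i hi ↦ proj_ofPi_of_notMem _ _ fun h ↦
      hi ((hA _ _).2 (((hA _ _).1 h).trans (Nat.lt_succ_self n)))
  let j : ∀ n, B n →L[𝕜] B (n + 1) := fun n ↦
    (((toPi 𝕜 E (A (n + 1))).comp (ofPi 𝕜 E (A n))).comp (B n).subtypeL).codRestrict (B (n + 1))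
      fun x ↦ by
        change ofPi 𝕜 E (A (n + 1)) (toPi 𝕜 E (A (n + 1)) (ofPi 𝕜 E (A n) x)) ∈ F
        rw [hsucc]
        exact x.2
  let i : ∀ n, B n →L[𝕜] F := fun n ↦
    ((ofPi 𝕜 E (A n)).comp (B n).subtypeL).codRestrict F fun x ↦ x.2
  obtain ⟨Q, hQ⟩ := hF
  have key : ∀ {G : Type (max v w)} [AddCommGroup G] [Module 𝕜 G] [TopologicalSpace G]
      [IsTopologicalAddGroup G] [ContinuousSMul 𝕜 G] [LocallyConvexSpace 𝕜 G] (g : F →ₗ[𝕜] G),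
      (∀ n, Continuous fun x ↦ g (i n x)) → Continuous g := by
    intro G _ _ _ _ _ _ g hg
    refine continuous_of_retract Q hQ g fun k ↦ ?_
    obtain ⟨n, hn⟩ := hcover _
      (finite_setOf_exists_proj_ne_zero (F.subtypeL.comp (Q.comp (inclL 𝕜 E k))))
    have hk : ∀ b, ofPi 𝕜 E (A n) (toPi 𝕜 E (A n) (Q (incl 𝕜 E k b))) = Q (incl 𝕜 E k b) :=
      fun b ↦ ofPi_toPi _ fun i hi ↦ not_not.1 fun h ↦ hi (hn ⟨b, h⟩)
    -- `Q` maps `E k` into one finite subsum, so its restriction factors through the single step `B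
    -- n`.
    let q : E k →L[𝕜] B n := ((toPi 𝕜 E (A n)).comp
      (F.subtypeL.comp (Q.comp (inclL 𝕜 E k)))).codRestrict (B n) fun b ↦ by
        change ofPi 𝕜 E (A n) (toPi 𝕜 E (A n) (Q (incl 𝕜 E k b))) ∈ F
        rw [hk]
        exact (Q _).2
    have hq : ∀ b, i n (q b) = Q (incl 𝕜 E k b) := fun b ↦ Subtype.ext (hk b)
    simp only [← hq]
    exact (hg n).comp q.continuous
  refine ⟨fun n ↦ B n, fun n ↦ inferInstance, fun n ↦ inferInstance,
    fun n ↦ (hB n).completeSpace_coe, j, fun n ↦ (i n : B n →ₗ[𝕜] F), ?_, ?_, ?_, ?_, ?_⟩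
  · intro n
    -- Forgetting the new coordinates is a continuous left inverse of `j n`.
    refine IsEmbedding.of_comp (j n).continuous
      (g := fun y : B (n + 1) ↦ toPi 𝕜 E (A n) (ofPi 𝕜 E (A (n + 1)) y)) (by fun_prop) ?_
    have : (fun y : B (n + 1) ↦ toPi 𝕜 E (A n) (ofPi 𝕜 E (A (n + 1)) y)) ∘ j n
        = Subtype.val := by
      funext x
      change toPi 𝕜 E (A n) (ofPi 𝕜 E (A (n + 1))
        (toPi 𝕜 E (A (n + 1)) (ofPi 𝕜 E (A n) x))) = x
      rw [hsucc, toPi_ofPi]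
    rw [this]
    exact IsEmbedding.subtypeVal
  · exact fun n x ↦ Subtype.ext (hsucc n x)
  · intro n x y h
    have h' : ofPi 𝕜 E (A n) x = ofPi 𝕜 E (A n) y := congrArg Subtype.val h
    exact Subtype.ext (by
      simpa only [toPi_ofPi] using congrArg (toPi 𝕜 E (A n)) h')
  · intro y
    obtain ⟨n, hn⟩ := hcover _ (finite_setOf_proj_ne_zero (y : LCDirectSum 𝕜 E))
    have hy := ofPi_toPi (A n) (x := (y : LCDirectSum 𝕜 E)) fun i hi ↦
      not_not.1 fun h ↦ hi (hn h)
    refine ⟨n, ⟨toPi 𝕜 E (A n) y, ?_⟩, Subtype.ext hy⟩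
    change ofPi 𝕜 E (A n) (toPi 𝕜 E (A n) y) ∈ F
    rw [hy]
    exact y.2
  · refine le_antisymm (le_sInf fun t ht ↦ ?_)
      (sInf_le ⟨inferInstance, inferInstance, inferInstance, fun n ↦ (i n).continuous⟩)
    rw [← continuous_id_iff_le]
    exact @key F _ _ t ht.1 ht.2.1 ht.2.2.1 LinearMap.id ht.2.2.2

end LB

end LCDirectSum

/-! ### Supports and strictly triangular operators -/

namespace LCDirectSum

section SupportedOn

variable {𝕜 : Type u} [RCLike 𝕜] {ι : Type v} {E : ι → Type w} [∀ i, AddCommGroup (E i)]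
  [∀ i, Module 𝕜 (E i)]

variable (𝕜 E) in
/-- The families that vanish outside a set of indices. -/
def supportedOn (S : Set ι) : Submodule 𝕜 (LCDirectSum 𝕜 E) :=
  ⨅ i ∈ Sᶜ, LinearMap.ker (proj 𝕜 E i)

theorem mem_supportedOn {S : Set ι} {x : LCDirectSum 𝕜 E} :
    x ∈ supportedOn 𝕜 E S ↔ ∀ i ∉ S, proj 𝕜 E i x = 0 := by
  simp [supportedOn, Submodule.mem_iInf]

theorem supportedOn_mono {S S' : Set ι} (h : S ⊆ S') :
    supportedOn 𝕜 E S ≤ supportedOn 𝕜 E S' := fun _ hx ↦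
  mem_supportedOn.2 fun i hi ↦ mem_supportedOn.1 hx i fun hS ↦ hi (h hS)

theorem map_mem_of_mem_supportedOn {G : Type*} [AddCommGroup G] [Module 𝕜 G]
    {M : Submodule 𝕜 G} (g : LCDirectSum 𝕜 E →ₗ[𝕜] G) {S : Set ι}
    (h : ∀ i ∈ S, ∀ b, g (incl 𝕜 E i b) ∈ M) {x : LCDirectSum 𝕜 E}
    (hx : x ∈ supportedOn 𝕜 E S) : g x ∈ M :=
  mem_of_forall_incl_mem g x fun i hi ↦ h i <| by
    by_contra hS
    exact hi (mem_supportedOn.1 hx i hS)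

variable [∀ i, TopologicalSpace (E i)]

theorem extend_mem_supportedOn (S : Set ι) (y : LCDirectSum 𝕜 (fun i : S ↦ E i)) :
    extend 𝕜 E S y ∈ supportedOn 𝕜 E S :=
  mem_supportedOn.2 fun _ hi ↦ proj_extend_of_notMem S hi y

theorem restrict_eq_zero {S S' : Set ι} (h : Disjoint S S') {x : LCDirectSum 𝕜 E}
    (hx : x ∈ supportedOn 𝕜 E S) : restrict 𝕜 E S' x = 0 := by
  ext i
  rw [proj_restrict, map_zero]
  exact mem_supportedOn.1 hx i fun hi ↦ Set.disjoint_left.1 h hi i.2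

theorem sub_extend_restrict_mem {S S' : Set ι} {x : LCDirectSum 𝕜 E}
    (hx : x ∈ supportedOn 𝕜 E (S ∪ S')) :
    x - extend 𝕜 E S' (restrict 𝕜 E S' x) ∈ supportedOn 𝕜 E S := by
  refine mem_supportedOn.2 fun i hi ↦ ?_
  rw [map_sub]
  by_cases h : i ∈ S'
  · rw [proj_extend_of_mem S' h, proj_restrict, sub_self]
  · rw [proj_extend_of_notMem S' h, mem_supportedOn.1 hx i (by simp [hi, h]), sub_zero]

end SupportedOn

section Triangular

variable {𝕜 : Type u} [RCLike 𝕜] {ι : Type v} {E : ι → Type w} [∀ i, NormedAddCommGroup (E i)]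
  [∀ i, NormedSpace 𝕜 (E i)] [∀ i, CompleteSpace (E i)]
  {J : Type*} [LinearOrder J] [WellFoundedLT J] (f : ι → J)

/-- If `N` is strictly triangular with respect to a well-ordered partition, then `1 - N` is
an automorphism. -/
theorem exists_equiv_apply_eq_sub (N : LCDirectSum 𝕜 E →L[𝕜] LCDirectSum 𝕜 E)
    (hN : ∀ i b, N (incl 𝕜 E i b) ∈ supportedOn 𝕜 E {k | f k < f i}) :
    ∃ U : LCDirectSum 𝕜 E ≃L[𝕜] LCDirectSum 𝕜 E, ∀ x, U x = x - N x := by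
  have hinv : ∀ i, ∃ I : E i →L[𝕜] LCDirectSum 𝕜 E, ∀ b, I b - N (I b) = incl 𝕜 E i b := by
    intro i
    induction i using (InvImage.wf f wellFounded_lt).induction with
    | _ i ih =>
    replace ih : ∀ k, ∃ I : E k →L[𝕜] LCDirectSum 𝕜 E,
        f k < f i → ∀ b, I b - N (I b) = incl 𝕜 E k b := fun k ↦ by
      -- The value zero is a filler at indices not below `i`, making the chosen family total.
      by_cases hk : f k < f i
      · obtain ⟨I, hI⟩ := ih k hk
        exact ⟨I, fun _ ↦ hI⟩
      · exact ⟨0, fun h ↦ absurd h hk⟩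
    choose I hI using ih
    have hfin := finite_setOf_exists_proj_ne_zero (N.comp (inclL 𝕜 E i))
    let s := hfin.toFinset
    have hs : ∀ k ∈ s, f k < f i := fun k hk ↦ by
      obtain ⟨b, hb⟩ := hfin.mem_toFinset.1 hk
      by_contra h
      exact hb (mem_supportedOn.1 (hN i b) k h)
    have hs' : ∀ b, ∀ k ∉ s, proj 𝕜 E k (N (incl 𝕜 E i b)) = 0 := fun b k hk ↦ by
      by_contra h
      exact hk (hfin.mem_toFinset.2 ⟨b, h⟩)
    -- The recursion `(1 - N)⁻¹ = 1 + (1 - N)⁻¹ N` on the summand `i`: `N` maps it into finitely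
    -- many strictly lower summands, where the inverse is already known.
    refine ⟨inclL 𝕜 E i +
      ∑ k ∈ s, (I k).comp ((projL 𝕜 E k).comp (N.comp (inclL 𝕜 E i))), fun b ↦ ?_⟩
    have hsum : ∑ k ∈ s, I k (proj 𝕜 E k (N (incl 𝕜 E i b))) -
        N (∑ k ∈ s, I k (proj 𝕜 E k (N (incl 𝕜 E i b)))) = N (incl 𝕜 E i b) := by
      rw [map_sum, ← Finset.sum_sub_distrib]
      refine Eq.trans ?_ (sum_incl_proj _ s (hs' b))
      exact Finset.sum_congr rfl fun k hk ↦ hI k (hs k hk) _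
    simp only [add_apply, sum_apply,
      ContinuousLinearMap.comp_apply, inclL_apply, projL_apply, map_add]
    rw [add_sub_add_comm, hsum, sub_add_cancel]
  choose I hI using hinv
  have hright : ∀ x, lift I x - N (lift I x) = x := fun x ↦ by
    have : (ContinuousLinearMap.id 𝕜 _ - N).comp (lift I) = .id 𝕜 _ :=
      continuousLinearMap_ext fun i b ↦ by simp [hI]
    exact DFunLike.congr_fun this x
  -- If `x = N x` is nonzero, its support has an index of maximal level, but `N x` lives strictly
  -- below that level. Injectivity makes the right inverse two-sided.
  have hinj : ∀ x, x - N x = 0 → x = 0 := by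
    intro x hx
    by_contra h0
    obtain ⟨s, hs, hsx⟩ := exists_sum_incl_proj x
    have hne : s.Nonempty := by
      rw [Finset.nonempty_iff_ne_empty]
      rintro rfl
      exact h0 (by rw [← hsx, Finset.sum_empty])
    obtain ⟨i, hi, hmax⟩ := s.exists_max_image f hne
    have hsupp : x ∈ supportedOn 𝕜 E {k | f k ≤ f i} := by
      rw [mem_supportedOn]
      intro k hk
      rw [← hsx, map_sum]
      exact Finset.sum_eq_zero fun l hl ↦
        proj_incl_of_ne (ne_of_mem_of_not_mem (a := l) (s := {k | f k ≤ f i}) (hmax l hl) hk).symm _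
    have hNx : N x ∈ supportedOn 𝕜 E {k | f k < f i} :=
      map_mem_of_mem_supportedOn (N : LCDirectSum 𝕜 E →ₗ[𝕜] LCDirectSum 𝕜 E)
        (fun k (hk : f k ≤ f i) b ↦
          supportedOn_mono (fun l (hl : f l < f k) ↦ hl.trans_le hk) (hN k b)) hsupp
    rw [← sub_eq_zero.1 hx] at hNx
    exact hs i hi (mem_supportedOn.1 hNx i (lt_irrefl (f i)))
  refine ⟨ContinuousLinearEquiv.equivOfInverse (ContinuousLinearMap.id 𝕜 (LCDirectSum 𝕜 E) - N) (lift I)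
    (fun x ↦ ?_) hright, fun x ↦ rfl⟩
  refine sub_eq_zero.1 (hinj _ ?_)
  rw [map_sub, sub_sub_sub_comm, hright]
  exact sub_self (x - N x)

end Triangular

end LCDirectSum

/-! ### Triangular idempotents and their diagonal blocks -/

namespace LCDirectSum

section DiagonalBlocks

variable {𝕜 : Type u} [RCLike 𝕜] {ι : Type v} {E : ι → Type w} [∀ i, AddCommGroup (E i)]
  [∀ i, Module 𝕜 (E i)] [∀ i, TopologicalSpace (E i)]

/-- The diagonal block of a continuous linear endomorphism of a direct sum. -/
noncomputable def diagBlock (P : LCDirectSum 𝕜 E →L[𝕜] LCDirectSum 𝕜 E) (S : Set ι) :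
    LCDirectSum 𝕜 (fun i : S ↦ E i) →L[𝕜] LCDirectSum 𝕜 (fun i : S ↦ E i) :=
  (restrict 𝕜 E S).comp (P.comp (extend 𝕜 E S))

theorem diagBlock_apply (P : LCDirectSum 𝕜 E →L[𝕜] LCDirectSum 𝕜 E) (S : Set ι)
    (y : LCDirectSum 𝕜 (fun i : S ↦ E i)) :
    diagBlock P S y = restrict 𝕜 E S (P (extend 𝕜 E S y)) := rfl

theorem rangeRestrict_diagBlock_eq_self (P : LCDirectSum 𝕜 E →L[𝕜] LCDirectSum 𝕜 E) (S : Set ι)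
    (hidem : ∀ y, diagBlock P S (diagBlock P S y) = diagBlock P S y)
    (y : (diagBlock P S).range) : (diagBlock P S).rangeRestrict y = y := by
  obtain ⟨_, z, rfl⟩ := y
  exact Subtype.ext (hidem z)

end DiagonalBlocks

section Idempotent

variable {𝕜 : Type u} [RCLike 𝕜] {ι : Type v} {E : ι → Type w} [∀ i, NormedAddCommGroup (E i)]
  [∀ i, NormedSpace 𝕜 (E i)]
  {J : Type*} [LinearOrder J] {f : ι → J}
  {P : LCDirectSum 𝕜 E →L[𝕜] LCDirectSum 𝕜 E}

theorem map_mem_supportedOn_le (htri : ∀ i b, P (incl 𝕜 E i b) ∈ supportedOn 𝕜 E {k | f k ≤ f i})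
    {j : J} {x : LCDirectSum 𝕜 E} (hx : x ∈ supportedOn 𝕜 E {k | f k ≤ j}) :
    P x ∈ supportedOn 𝕜 E {k | f k ≤ j} :=
  map_mem_of_mem_supportedOn (P : LCDirectSum 𝕜 E →ₗ[𝕜] LCDirectSum 𝕜 E)
    (fun i (hi : f i ≤ j) b ↦
      supportedOn_mono (fun k (hk : f k ≤ f i) ↦ hk.trans hi) (htri i b)) hx

theorem map_mem_supportedOn_lt (htri : ∀ i b, P (incl 𝕜 E i b) ∈ supportedOn 𝕜 E {k | f k ≤ f i})
    {j : J} {x : LCDirectSum 𝕜 E} (hx : x ∈ supportedOn 𝕜 E {k | f k < j}) :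
    P x ∈ supportedOn 𝕜 E {k | f k < j} :=
  map_mem_of_mem_supportedOn (P : LCDirectSum 𝕜 E →ₗ[𝕜] LCDirectSum 𝕜 E)
    (fun i (hi : f i < j) b ↦
      supportedOn_mono (fun k (hk : f k ≤ f i) ↦ hk.trans_lt hi) (htri i b)) hx

theorem sub_extend_restrict_fiber_mem {j : J} {x : LCDirectSum 𝕜 E}
    (hx : x ∈ supportedOn 𝕜 E {k | f k ≤ j}) :
    x - extend 𝕜 E (f ⁻¹' {j}) (restrict 𝕜 E (f ⁻¹' {j}) x) ∈ supportedOn 𝕜 E {k | f k < j} :=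
  sub_extend_restrict_mem
    (supportedOn_mono (fun _ (hk : f _ ≤ j) ↦ hk.lt_or_eq) hx)

theorem restrict_fiber_eq_zero {j : J} {x : LCDirectSum 𝕜 E}
    (hx : x ∈ supportedOn 𝕜 E {k | f k < j}) : restrict 𝕜 E (f ⁻¹' {j}) x = 0 :=
  restrict_eq_zero (Set.disjoint_left.2 fun _ hk hk' ↦ (ne_of_lt hk) hk') hx

theorem extend_fiber_mem (j : J) (y : LCDirectSum 𝕜 (fun i : f ⁻¹' {j} ↦ E i)) :
    extend 𝕜 E (f ⁻¹' {j}) y ∈ supportedOn 𝕜 E {k | f k ≤ j} :=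
  supportedOn_mono (fun _ hk ↦ le_of_eq hk) (extend_mem_supportedOn _ y)

/-- The diagonal blocks of a triangular idempotent are idempotent. -/
theorem diagBlock_idem (hP : ∀ x, P (P x) = P x)
    (htri : ∀ i b, P (incl 𝕜 E i b) ∈ supportedOn 𝕜 E {k | f k ≤ f i}) (j : J)
    (y : LCDirectSum 𝕜 (fun i : f ⁻¹' {j} ↦ E i)) :
    diagBlock P (f ⁻¹' {j}) (diagBlock P (f ⁻¹' {j}) y) = diagBlock P (f ⁻¹' {j}) y := by
  simp only [diagBlock_apply]
  -- Cutting `P x` down to level `j` discards only lower terms, and `P` keeps those below `j`; so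
  -- they do not affect the block of `P (P x) = P x`.
  have h := restrict_fiber_eq_zero (map_mem_supportedOn_lt htri (sub_extend_restrict_fiber_mem
    (map_mem_supportedOn_le htri (extend_fiber_mem j y))))
  rw [map_sub, map_sub, hP] at h
  exact (sub_eq_zero.1 h).symm

variable [∀ i, CompleteSpace (E i)] [WellFoundedLT J]

/-- The range of an idempotent that is triangular with respect to a well-ordered partition is
isomorphic to the direct sum of the ranges of the diagonal blocks. -/
theorem nonempty_equiv_range_diagBlock {X : Submodule 𝕜 (LCDirectSum 𝕜 E)}
    (π : LCDirectSum 𝕜 E →L[𝕜] X) (hπ : ∀ x : X, π x = x)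
    (htri : ∀ i b, (π (incl 𝕜 E i b) : LCDirectSum 𝕜 E) ∈ supportedOn 𝕜 E {k | f k ≤ f i}) :
    Nonempty (X ≃L[𝕜] LCDirectSum 𝕜
      (fun j : J ↦ (diagBlock (X.subtypeL.comp π) (f ⁻¹' {j})).range)) := by
  set P : LCDirectSum 𝕜 E →L[𝕜] LCDirectSum 𝕜 E := X.subtypeL.comp π
  have hP : ∀ x, P (P x) = P x := fun x ↦ congrArg Subtype.val (hπ (π x))
  replace htri : ∀ i b, P (incl 𝕜 E i b) ∈ supportedOn 𝕜 E {k | f k ≤ f i} := htri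
  let F : ∀ j : J, Submodule 𝕜 (LCDirectSum 𝕜 (fun i : f ⁻¹' {j} ↦ E i)) := fun j : J ↦ (diagBlock P (f ⁻¹' {j})).range
  let G : LCDirectSum 𝕜 E →L[𝕜] LCDirectSum 𝕜 (fun j ↦ F j) := lift fun i ↦
    (inclL 𝕜 (fun j ↦ F j) (f i)).comp
      ((diagBlock P (f ⁻¹' {f i})).rangeRestrict.comp
        ((restrict 𝕜 E (f ⁻¹' {f i})).comp (inclL 𝕜 E i)))
  let H : LCDirectSum 𝕜 (fun j ↦ F j) →L[𝕜] LCDirectSum 𝕜 E := lift fun j ↦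
    (extend 𝕜 E (f ⁻¹' {j})).comp (F j).subtypeL
  have hH : ∀ j (y : F j), H (incl 𝕜 (fun j ↦ F j) j y) = extend 𝕜 E (f ⁻¹' {j}) y :=
    fun j y ↦ lift_incl ..
  have hG : ∀ i b, G (incl 𝕜 E i b) = incl 𝕜 (fun j ↦ F j) (f i)
      ((diagBlock P (f ⁻¹' {f i})).rangeRestrict
        (restrict 𝕜 E (f ⁻¹' {f i}) (incl 𝕜 E i b))) := fun i b ↦ lift_incl ..
  have hGextend : ∀ j (z : LCDirectSum 𝕜 (fun i : f ⁻¹' {j} ↦ E i)),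
      G (extend 𝕜 E (f ⁻¹' {j}) z) =
        incl 𝕜 (fun j ↦ F j) j ((diagBlock P (f ⁻¹' {j})).rangeRestrict z) := by
    intro j z
    have : G.comp (extend 𝕜 E (f ⁻¹' {j})) =
        (inclL 𝕜 (fun j ↦ F j) j).comp (diagBlock P (f ⁻¹' {j})).rangeRestrict := by
      refine continuousLinearMap_ext fun k b ↦ ?_
      obtain ⟨k, hk⟩ := k
      obtain rfl : f k = j := hk
      simp only [ContinuousLinearMap.comp_apply, extend_incl, inclL_apply]
      rw [hG, restrict_incl_of_mem _ (show k ∈ f ⁻¹' {f k} from rfl)]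
    exact DFunLike.congr_fun this z
  have hGH : ∀ y, G (H y) = y := by
    intro y
    have : G.comp H = .id 𝕜 _ := by
      refine continuousLinearMap_ext fun j y ↦ ?_
      change G (H _) = _
      rw [hH, hGextend, rangeRestrict_diagBlock_eq_self _ _ (diagBlock_idem hP htri j)]
      rfl
    exact DFunLike.congr_fun this y
  have hHG : ∀ i b, H (G (incl 𝕜 E i b)) =
      extend 𝕜 E (f ⁻¹' {f i}) (restrict 𝕜 E (f ⁻¹' {f i}) (P (incl 𝕜 E i b))) := by
    intro i b
    rw [hG, hH]
    have hi : extend 𝕜 E (f ⁻¹' {f i}) (restrict 𝕜 E (f ⁻¹' {f i}) (incl 𝕜 E i b)) =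
        incl 𝕜 E i b := by
      rw [restrict_incl_of_mem _ (show i ∈ f ⁻¹' {f i} from rfl), extend_incl]
    change extend 𝕜 E _ (diagBlock P _ _) = _
    rw [diagBlock_apply, hi]
  -- With `D = H G`, this is `1 - U` for `U = P D + (1 - P)(1 - D)`. It equals `2 P (P - D) - (P -
  -- D)`, and `P - D` is strictly triangular.
  let N : LCDirectSum 𝕜 E →L[𝕜] LCDirectSum 𝕜 E :=
    P + H.comp G - (2 : 𝕜) • P.comp (H.comp G)
  have hN : ∀ x, N x = P x + H (G x) - (2 : 𝕜) • P (H (G x)) := fun x ↦ rfl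
  obtain ⟨U, hU⟩ := exists_equiv_apply_eq_sub f N fun i b ↦ by
    have hl := sub_extend_restrict_fiber_mem (htri i b)
    rw [← hHG] at hl
    have hPl := map_mem_supportedOn_lt htri hl
    have : N (incl 𝕜 E i b) = (2 : 𝕜) • P (P (incl 𝕜 E i b) - H (G (incl 𝕜 E i b))) -
        (P (incl 𝕜 E i b) - H (G (incl 𝕜 E i b))) := by
      rw [hN, map_sub, hP]
      module
    rw [this]
    exact Submodule.sub_mem _ (Submodule.smul_mem _ _ hPl) hl
  have hUD : ∀ x, U (H (G x)) = P (H (G x)) := fun x ↦ by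
    rw [hU, hN, hGH]
    module
  have hPU : ∀ x, P (U x) = P (H (G x)) := fun x ↦ by
    rw [hU, hN, map_sub, map_sub, map_add, map_smul, hP, hP]
    module
  -- Since `U D = P U`, the maps `G U⁻¹` on `X` and `π U H` are mutually inverse.
  refine ⟨ContinuousLinearEquiv.equivOfInverse
    (G.comp ((U.symm : LCDirectSum 𝕜 E →L[𝕜] LCDirectSum 𝕜 E).comp X.subtypeL))
    (π.comp ((U : LCDirectSum 𝕜 E →L[𝕜] LCDirectSum 𝕜 E).comp H)) (fun x ↦ ?_) fun y ↦ ?_⟩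
  · change π (U (H (G (U.symm x)))) = x
    rw [hUD, ← hPU, U.apply_symm_apply]
    exact (hπ (π x)).trans (hπ x)
  · change G (U.symm (P (U (H y)))) = y
    rw [hPU, ← hUD, U.symm_apply_apply, hGH, hGH]

end Idempotent

end LCDirectSum

/-! ### The decomposition theorem -/

theorem theoremT {𝕜 : Type w} [RCLike 𝕜] {T : Type u} [Uncountable T] (B : T → Type v)
    [∀ t, NormedAddCommGroup (B t)] [∀ t, NormedSpace 𝕜 (B t)] [∀ t, CompleteSpace (B t)]
    (X : Submodule 𝕜 (LCDirectSum 𝕜 B)) (hX : X.ClosedComplemented) :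
    ∃ (J : Type u) (S : J → Set T)
      (F : ∀ j, Submodule 𝕜 (LCDirectSum 𝕜 (fun t : S j ↦ B t))),
      (∀ j, Cardinal.mk (S j) = Cardinal.aleph0) ∧
      (∀ j, (F j).ClosedComplemented) ∧
      (∀ j, IsLBSpace 𝕜 (F j)) ∧
      Nonempty (X ≃L[𝕜] LCDirectSum 𝕜 (fun j ↦ F j)) := by
  obtain ⟨π, hπ⟩ := hX
  let P : LCDirectSum 𝕜 B →L[𝕜] LCDirectSum 𝕜 B := X.subtypeL.comp π
  have hP : ∀ x, P (P x) = P x := fun x ↦ congrArg Subtype.val (hπ (π x))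
  obtain ⟨J, _, _, f, hf, hcard⟩ := exists_wellOrdered_partition
    (fun t ↦ {s | ∃ b, LCDirectSum.proj 𝕜 B s (P (LCDirectSum.incl 𝕜 B t b)) ≠ 0})
    fun t ↦ (LCDirectSum.finite_setOf_exists_proj_ne_zero
      (P.comp (LCDirectSum.inclL 𝕜 B t))).countable
  have htri : ∀ t b, P (LCDirectSum.incl 𝕜 B t b) ∈
      LCDirectSum.supportedOn 𝕜 B {s | f s ≤ f t} := fun t b ↦
    LCDirectSum.mem_supportedOn.2 fun s hs ↦ by
      by_contra h
      exact hs (hf t s ⟨b, h⟩)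
  have hcompl : ∀ j, (LCDirectSum.diagBlock P (f ⁻¹' {j})).range.ClosedComplemented := fun j ↦
    ⟨(LCDirectSum.diagBlock P (f ⁻¹' {j})).rangeRestrict,
      LCDirectSum.rangeRestrict_diagBlock_eq_self _ _ (LCDirectSum.diagBlock_idem hP htri j)⟩
  refine ⟨J, fun j ↦ f ⁻¹' {j}, fun j ↦ (LCDirectSum.diagBlock P (f ⁻¹' {j})).range, hcard,
    hcompl, fun j ↦ ?_, LCDirectSum.nonempty_equiv_range_diagBlock π hπ htri⟩
  have : Countable (f ⁻¹' {j}) := Cardinal.mk_le_aleph0_iff.1 (hcard j).le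
  exact LCDirectSum.isLBSpace_of_closedComplemented _ (hcompl j)
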